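/- Let $A=[A(i,j)]_{i,j=1}^N$ and $B=[B(i,j)]_{i,j=1}^M$ be irreducible, non-permutation square matrices with entries in $\{0,1\}$. For such an $A$, let $\bar X_A=\{(x_n)_{n\in\mathbb Z}\in\{1,\dots,N\}^{\mathbb Z} : A(x_n,x_{n+1})=1 \text{ for all } n\in\mathbb Z\}$, with the topology induced by the product topology, and let $\bar\sigma_A((x_n)_n)=(x_{n+1})_n$ be the shift homeomorphism. Let $\Delta_A$ be the inductive limit of $\mathbb Z^N\xrightarrow{A^t}\mathbb Z^N\xrightarrow{A^t}\cdots$, and write $[v,n]$ ($v\in\mathbb Z^N$, $n\ge 0$) for the class of $v$ at stage $n$, so that $[v,n]=[A^tv,n+1]$. Put $\Delta_A^+=\{[v,n] : v\in\mathbb Z_{\ge 0}^N,\ n\ge 0\}$, and let $\delta_A$ be the automorphism $\delta_A([v,n])=[v,n+1]$ of $\Delta_A$. The *dimension quadruplet* $(\tilde\Delta_A,\tilde\Delta_A^+,\tilde\delta_A,\tilde u_A)$ of $(\bar X_A,\bar\sigma_A)$ consists of $$\tilde\Delta_A=\Delta_{A^t}\otimes_{\mathbb Z}\Delta_A,\qquad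 \tilde\delta_A=\delta_{A^t}^{-1}\otimes\delta_A,\qquad \tilde u_A=\sum_{i,j=1}^N [e_j,1]\otimes A(j,i)[e_i,1],$$ where $e_1,\dots,e_N$ is the standard basis of $\mathbb Z^N$, together with the positive cone $\tilde\Delta_A^+=\Delta_{A^t}^+\otimes\Delta_A^+$, that is, the set of all finite sums of elements $a\otimes b$ with $a\in\Delta_{A^t}^+$ and $b\in\Delta_A^+$. **Proposition.** The dimension quadruplet is invariant under topological conjugacy of two-sided topological Markov shifts: if there is a homeomorphism $h:\bar X_A\to\bar X_B$ with $h\circ\bar\sigma_A=\bar\sigma_B\circ h$, then there is a group isomorphism $\Phi:\tilde\Delta_A\to\tilde\Delta_B$ such that $\Phi(\tilde\Delta_A^+)=\tilde\Delta_B^+$, $\Phi\circ\tilde\delta_A=\tilde\delta_B\circ\Phi$ and $\Phi(\tilde u_A)=\tilde u_B$. -/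

import Mathlib

open scoped TensorProduct

/-! ### Two-sided topological Markov shifts -/

/-- The two-sided shift space of a `0`-`1` matrix `A`: bi-infinite sequences of symbols all of whose
transitions are allowed by `A`.  It carries the subspace topology of the product topology. -/
def MarkovShift {ι : Type*} (A : Matrix ι ι ℤ) : Set (ℤ → ι) :=
  {x | ∀ n : ℤ, A (x n) (x (n + 1)) = 1}

/-- The shift homeomorphism `(x_n)_n ↦ (x_{n+1})_n` of the shift space. -/
def markovShiftMap {ι : Type*} [TopologicalSpace ι] (A : Matrix ι ι ℤ) :
    MarkovShift A ≃ₜ MarkovShift A where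
  toFun x := ⟨fun n => x.1 (n + 1), fun n => x.2 (n + 1)⟩
  invFun x := ⟨fun n => x.1 (n - 1), fun n => by
    have h := x.2 (n - 1)
    rwa [show n - 1 + 1 = n + 1 - 1 by ring] at h⟩
  left_inv x := by
    apply Subtype.ext
    funext n
    simp
  right_inv x := by
    apply Subtype.ext
    funext n
    simp
  continuous_toFun := by
    refine Continuous.subtype_mk (continuous_pi fun n => ?_) _
    exact (continuous_apply (n + 1)).comp continuous_subtype_val
  continuous_invFun := by
    refine Continuous.subtype_mk (continuous_pi fun n => ?_) _
    exact (continuous_apply (n - 1)).comp continuous_subtype_val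

/-- Topological conjugacy of the two-sided topological Markov shifts of `A` and `B`. -/
def TopologicallyConjugate {ι κ : Type*} [TopologicalSpace ι] [TopologicalSpace κ]
    (A : Matrix ι ι ℤ) (B : Matrix κ κ ℤ) : Prop :=
  ∃ h : MarkovShift A ≃ₜ MarkovShift B, ∀ x, h (markovShiftMap A x) = markovShiftMap B (h x)

/-- `A` is the matrix of a permutation. -/
def IsPermutationMatrix {ι : Type*} [DecidableEq ι] (A : Matrix ι ι ℤ) : Prop :=
  ∃ σ : Equiv.Perm ι, A = σ.permMatrix ℤ

noncomputable section

/-! ### The dimension triplet -/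

section Dimension

variable {ι : Type*} [Fintype ι] [DecidableEq ι]

/-- The connecting map from stage `i` to stage `j` of `ℤ^N → ℤ^N → ⋯`, every single step of which is
multiplication by the transpose of `A`. -/
def dimMap (A : Matrix ι ι ℤ) (i j : ℕ) (_ : i ≤ j) : (ι → ℤ) →ₗ[ℤ] (ι → ℤ) :=
  (A.transpose ^ (j - i)).mulVecLin

/-- The dimension group `Δ_A`, the inductive limit of `ℤ^N → ℤ^N → ⋯` along `Aᵗ`. -/
def DimGroup (A : Matrix ι ι ℤ) : Type _ :=
  Module.DirectLimit (fun _ : ℕ => ι → ℤ) (dimMap A)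

instance (A : Matrix ι ι ℤ) : AddCommGroup (DimGroup A) :=
  inferInstanceAs (AddCommGroup (Module.DirectLimit (fun _ : ℕ => ι → ℤ) (dimMap A)))

/-- The class `[v, n]` in `Δ_A` of the vector `v` at stage `n`. -/
def dimClass (A : Matrix ι ι ℤ) (v : ι → ℤ) (n : ℕ) : DimGroup A :=
  Module.DirectLimit.of ℤ ℕ (fun _ : ℕ => ι → ℤ) (dimMap A) n v

/-- The positive cone `Δ_A⁺`: the classes of nonnegative vectors. -/
def dimCone (A : Matrix ι ι ℤ) : Set (DimGroup A) :=
  {x | ∃ (v : ι → ℤ) (n : ℕ), 0 ≤ v ∧ x = dimClass A v n}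

theorem exists_dimClass (A : Matrix ι ι ℤ) (x : DimGroup A) :
    ∃ (v : ι → ℤ) (n : ℕ), x = dimClass A v n := by
  obtain ⟨n, v, h⟩ := Module.DirectLimit.exists_of x
  exact ⟨v, n, h.symm⟩

/-- The defining relation `[v, n] = [Aᵗ v, n + 1]`. -/
theorem dimClass_succ (A : Matrix ι ι ℤ) (v : ι → ℤ) (n : ℕ) :
    dimClass A (A.transpose.mulVec v) (n + 1) = dimClass A v n := by
  have h := Module.DirectLimit.of_f (R := ℤ) (ι := ℕ) (G := fun _ : ℕ => ι → ℤ) (f := dimMap A)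
    (i := n) (j := n + 1) (hij := Nat.le_succ n) (x := v)
  have e : dimMap A n (n + 1) (Nat.le_succ n) v = A.transpose.mulVec v := by
    simp only [dimMap, Nat.add_sub_cancel_left, pow_one, Matrix.mulVecLin_apply]
  rw [e] at h
  exact h

theorem dimShift_compat (A : Matrix ι ι ℤ) (i j : ℕ) (hij : i ≤ j) (v : ι → ℤ) :
    Module.DirectLimit.of ℤ ℕ (fun _ : ℕ => ι → ℤ) (dimMap A) (j + 1) (dimMap A i j hij v) =
      Module.DirectLimit.of ℤ ℕ (fun _ : ℕ => ι → ℤ) (dimMap A) (i + 1) v := by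
  have h := Module.DirectLimit.of_f (R := ℤ) (ι := ℕ) (G := fun _ : ℕ => ι → ℤ)
    (f := dimMap A) (i := i + 1) (j := j + 1) (hij := Nat.succ_le_succ hij) (x := v)
  have e : dimMap A (i + 1) (j + 1) (Nat.succ_le_succ hij) v = dimMap A i j hij v := by
    simp only [dimMap, Nat.add_sub_add_right]
  rw [e] at h
  exact h

theorem dimUnshift_compat (A : Matrix ι ι ℤ) (i j : ℕ) (hij : i ≤ j) :
    A.transpose.mulVecLin ∘ₗ dimMap A i j hij = dimMap A i j hij ∘ₗ A.transpose.mulVecLin := by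
  simp only [dimMap, ← Matrix.mulVecLin_mul]
  rw [← pow_succ, ← pow_succ']

/-- The endomorphism `[v, n] ↦ [v, n + 1]` of `Δ_A`. -/
def dimShift (A : Matrix ι ι ℤ) : DimGroup A →+ DimGroup A :=
  LinearMap.toAddMonoidHom (Module.DirectLimit.lift ℤ ℕ (fun _ : ℕ => ι → ℤ) (dimMap A)
    (fun n => Module.DirectLimit.of ℤ ℕ (fun _ : ℕ => ι → ℤ) (dimMap A) (n + 1))
    (dimShift_compat A))

/-- The endomorphism `[v, n] ↦ [Aᵗ v, n]` of `Δ_A`. -/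
def dimUnshift (A : Matrix ι ι ℤ) : DimGroup A →+ DimGroup A :=
  LinearMap.toAddMonoidHom (Module.DirectLimit.map (f := dimMap A) (f' := dimMap A)
    (fun _ => A.transpose.mulVecLin) (dimUnshift_compat A))

theorem dimShift_dimClass (A : Matrix ι ι ℤ) (v : ι → ℤ) (n : ℕ) :
    dimShift A (dimClass A v n) = dimClass A v (n + 1) :=
  Module.DirectLimit.lift_of
    (fun n => Module.DirectLimit.of ℤ ℕ (fun _ : ℕ => ι → ℤ) (dimMap A) (n + 1))
    (dimShift_compat A) v

theorem dimUnshift_dimClass (A : Matrix ι ι ℤ) (v : ι → ℤ) (n : ℕ) :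
    dimUnshift A (dimClass A v n) = dimClass A (A.transpose.mulVec v) n :=
  Module.DirectLimit.map_apply_of (fun _ => A.transpose.mulVecLin) (dimUnshift_compat A) v

/-- The dimension drop automorphism `δ_A`, `[v, n] ↦ [v, n + 1]`, with inverse
`[v, n] ↦ [Aᵗ v, n]`. -/
def dimAut (A : Matrix ι ι ℤ) : DimGroup A ≃+ DimGroup A where
  toFun := dimShift A
  map_add' := map_add (dimShift A)
  invFun := dimUnshift A
  left_inv x := by
    obtain ⟨v, n, rfl⟩ := exists_dimClass A x
    rw [dimShift_dimClass, dimUnshift_dimClass, dimClass_succ]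
  right_inv x := by
    obtain ⟨v, n, rfl⟩ := exists_dimClass A x
    rw [dimUnshift_dimClass, dimShift_dimClass, dimClass_succ]

/-! ### The dimension quadruplet -/

/-- The bilateral dimension group `Δ_{Aᵗ} ⊗ Δ_A`. -/
abbrev BiDimGroup (A : Matrix ι ι ℤ) : Type _ :=
  DimGroup A.transpose ⊗[ℤ] DimGroup A

/-- The positive cone `Δ_{Aᵗ}⁺ ⊗ Δ_A⁺`: all finite sums of `a ⊗ b` with `a` and `b` positive. -/
def biDimCone (A : Matrix ι ι ℤ) : AddSubmonoid (BiDimGroup A) :=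
  AddSubmonoid.closure
    {z | ∃ a ∈ dimCone A.transpose, ∃ b ∈ dimCone A, z = a ⊗ₜ[ℤ] b}

/-- The automorphism `δ_{Aᵗ}⁻¹ ⊗ δ_A`. -/
def biDimAut (A : Matrix ι ι ℤ) : BiDimGroup A ≃+ BiDimGroup A :=
  (TensorProduct.congr (dimAut A.transpose).symm.toIntLinearEquiv
    (dimAut A).toIntLinearEquiv).toAddEquiv

/-- The distinguished element `∑_{i,j} [e_j, 1] ⊗ A(j,i) [e_i, 1]`. -/
def biDimUnit (A : Matrix ι ι ℤ) : BiDimGroup A :=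
  ∑ i : ι, ∑ j : ι,
    dimClass A.transpose (Pi.single j 1) 1 ⊗ₜ[ℤ] (A j i • dimClass A (Pi.single i 1) 1)

/-- Isomorphism of the dimension quadruplets of `A` and `B`: a group isomorphism that maps positive
cone onto positive cone, intertwines the automorphisms and matches the distinguished elements. -/
def DimQuadrupletIso {κ : Type*} [Fintype κ] [DecidableEq κ]
    (A : Matrix ι ι ℤ) (B : Matrix κ κ ℤ) : Prop :=
  ∃ Φ : BiDimGroup A ≃+ BiDimGroup B,
    Φ '' (biDimCone A : Set (BiDimGroup A)) = (biDimCone B : Set (BiDimGroup B)) ∧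
    (∀ z, Φ (biDimAut A z) = biDimAut B (Φ z)) ∧
    Φ (biDimUnit A) = biDimUnit B

end Dimension

end

/-! The conjugacy puts two codings p and q on one space, and by compactness each coordinate of one
depends on a bounded window of the other. Fix a reference past and future for every symbol, and
count the points whose p-past up to time i and q-future from time j are the references of a and b.
If the time gaps are at least the window radii, a point can be cut at an intermediate time and
reglued, so these counting matrices multiply (`transfer_mul_transfer`). Counting p against itself
over one time unit gives A, and the counts are shift invariant. Hence the matrices R from p to q and
S from q to p form a nonnegative shift equivalence: AR = RB, SA = BS, RS = A^l, SR = B^l.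

On dimension groups, S acts on the first tensor factor by [v, m] ↦ [Sv, m], and Rᵗ acts on the
second with a delay, [w, n] ↦ [Rᵗw, n + l]. Nonnegativity of R and S preserves the cones in both
directions. The distinguished element has coefficient matrix A, which becomes SAR = BSR = B^(l+1);
the delay l absorbs the surplus factor B^l. -/

/-! ### Codings of a set by Markov shifts and their transfer matrices -/

/-- An identification of `X` with the Markov shift of `A`, together with a reference sequence
passing through every symbol at time `0`. -/
structure MarkovCoding (X : Type*) {ι : Type*} (A : Matrix ι ι ℤ) where
  toEquiv : X ≃ MarkovShift A
  base : ι → MarkovShift A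
  base_zero : ∀ a, (base a).1 0 = a

namespace MarkovCoding

variable {X ι κ τ : Type*} {A : Matrix ι ι ℤ} {B : Matrix κ κ ℤ} {C : Matrix τ τ ℤ}

/-- The symbol sequence of a point. -/
def seq (p : MarkovCoding X A) (x : X) (n : ℤ) : ι := (p.toEquiv x).1 n

theorem seq_mem (p : MarkovCoding X A) (x : X) (n : ℤ) : A (p.seq x n) (p.seq x (n + 1)) = 1 :=
  (p.toEquiv x).2 n

theorem seq_ext (p : MarkovCoding X A) {x y : X} (h : ∀ n, p.seq x n = p.seq y n) : x = y :=
  p.toEquiv.injective (Subtype.ext (funext h))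

/-- A past and a future joined by an allowed transition come from a point. -/
theorem exists_join (p : MarkovCoding X A) (u v : MarkovShift A) (j : ℤ)
    (h : A (u.1 0) (v.1 1) = 1) :
    ∃ y : X, (∀ n ≤ 0, p.seq y (n + j) = u.1 n) ∧ ∀ n > 0, p.seq y (n + j) = v.1 n := by
  have hw : ∀ n : ℤ, A (if n ≤ j then u.1 (n - j) else v.1 (n - j))
      (if n + 1 ≤ j then u.1 (n + 1 - j) else v.1 (n + 1 - j)) = 1 := fun n => by
    rcases lt_trichotomy n j with hn | rfl | hn
    · have := u.2 (n - j)
      rw [if_pos hn.le, if_pos (show n + 1 ≤ j by lia)]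
      rwa [show n - j + 1 = n + 1 - j by ring] at this
    · simpa using h
    · have := v.2 (n - j)
      rw [if_neg hn.not_ge, if_neg (show ¬ n + 1 ≤ j by lia)]
      rwa [show n - j + 1 = n + 1 - j by ring] at this
  refine ⟨p.toEquiv.symm ⟨fun n => if n ≤ j then u.1 (n - j) else v.1 (n - j), hw⟩,
    fun n hn => ?_, fun n hn => ?_⟩
  · simp [seq, hn]
  · simp [seq, hn.not_ge]

theorem exists_glue (p : MarkovCoding X A) (u v : MarkovShift A) (j : ℤ) (h : u.1 0 = v.1 0) :
    ∃ y : X, (∀ n ≤ 0, p.seq y (n + j) = u.1 n) ∧ ∀ n ≥ 0, p.seq y (n + j) = v.1 n := by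
  obtain ⟨y, h1, h2⟩ := p.exists_join u v j (by rw [h]; exact v.2 0)
  refine ⟨y, h1, fun n hn => ?_⟩
  rcases hn.eq_or_lt with rfl | hn
  · rw [h1 0 le_rfl, h]
  · exact h2 n hn

/-! ### Local determination and counting matrices -/

/-- The coordinates of `q` depend on the coordinates of `p` in a window of radius `k`. -/
def Determines (p : MarkovCoding X A) (k : ℕ) (q : MarkovCoding X B) : Prop :=
  ∀ x y (m : ℤ), (∀ n : ℤ, m - k ≤ n → n ≤ m + k → p.seq x n = p.seq y n) → q.seq x m = q.seq y m

theorem determines_self (p : MarkovCoding X A) : p.Determines 0 p :=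
  fun _ _ m h => h m (by simp) (by simp)

/-- The points whose `p`-past up to time `i` is the reference past of `a` and whose `q`-future from
time `j` is the reference future of `b`. -/
def transit (p : MarkovCoding X A) (q : MarkovCoding X B) (i j : ℤ) (a : ι) (b : κ) : Set X :=
  {x | (∀ n ≤ 0, p.seq x (n + i) = (p.base a).1 n) ∧ ∀ n ≥ 0, q.seq x (n + j) = (q.base b).1 n}

/-- The matrix counting the points in the transit sets. -/
noncomputable def transfer (p : MarkovCoding X A) (q : MarkovCoding X B) (i j : ℤ) :
    Matrix ι κ ℤ :=
  Matrix.of fun a b => (Nat.card (p.transit q i j a b) : ℤ)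

theorem transfer_nonneg (p : MarkovCoding X A) (q : MarkovCoding X B) (i j : ℤ) (a : ι) (b : κ) :
    0 ≤ p.transfer q i j a b :=
  Int.natCast_nonneg _

/-- The p-coordinates up to time i are prescribed, and those after j + k see only the prescribed
q-future, so only the finitely many coordinates in between are free. -/
theorem finite_transit [Finite ι] {p : MarkovCoding X A} {q : MarkovCoding X B} {k : ℕ}
    (h : q.Determines k p) (i j : ℤ) (a : ι) (b : κ) : Finite (p.transit q i j a b) := by
  refine Finite.of_injective (β := Finset.Icc i (j + k) → ι)
    (fun x n => p.seq x.1 n.1) fun x y hxy => Subtype.ext (p.seq_ext fun n => ?_)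
  rcases le_or_gt n i with hn | hn
  · have hx := x.2.1 (n - i) (by lia)
    have hy := y.2.1 (n - i) (by lia)
    rw [sub_add_cancel] at hx hy
    rw [hx, hy]
  rcases le_or_gt n (j + k) with hn' | hn'
  · exact congrFun hxy ⟨n, Finset.mem_Icc.2 ⟨hn.le, hn'⟩⟩
  · refine h _ _ _ fun m hm _ => ?_
    have hx := x.2.2 (m - j) (by lia)
    have hy := y.2.2 (m - j) (by lia)
    rw [sub_add_cancel] at hx hy
    rw [hx, hy]

/-- A point is cut at time j, with b its q-symbol there: one piece keeps the q-past and takes the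
reference future of b, the other keeps the q-future and takes the reference past. Since i + k ≤ j,
the p-past up to i sees only q-coordinates up to j, so changing the q-future leaves it intact; j + l
≤ m does the same for the r-future. Gluing the two pieces at j is the inverse. -/
theorem card_transit_eq_card_sigma {p : MarkovCoding X A} {q : MarkovCoding X B}
    {r : MarkovCoding X C} {k l : ℕ} (hqp : q.Determines k p) (hqr : q.Determines l r) {i j m : ℤ}
    (hij : i + k ≤ j) (hjm : j + l ≤ m) (a : ι) (c : τ) :
    Nat.card (p.transit r i m a c) =
      Nat.card ((b : κ) × (p.transit q i j a b × q.transit r j m b c)) := by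
  have past : ∀ {x y : X}, (∀ n ≤ 0, q.seq x (n + j) = q.seq y (n + j)) →
      ∀ n ≤ 0, p.seq x (n + i) = p.seq y (n + i) := fun {x y} h n hn =>
    hqp _ _ _ fun s _ hs => by simpa using h (s - j) (by lia)
  have future : ∀ {x y : X}, (∀ n ≥ 0, q.seq x (n + j) = q.seq y (n + j)) →
      ∀ n ≥ 0, r.seq x (n + m) = r.seq y (n + m) := fun {x y} h n hn =>
    hqr _ _ _ fun s hs _ => by simpa using h (s - j) (by lia)
  have shifted : ∀ x : X, ∃ v : MarkovShift B, ∀ n, q.seq x (n + j) = v.1 n := fun x =>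
    ⟨⟨fun n => q.seq x (n + j), fun n => by
      simpa [add_right_comm] using q.seq_mem x (n + j)⟩, fun _ => rfl⟩
  have glue : ∀ x y : X, q.seq x j = q.seq y j → ∃ z,
      (∀ n ≤ 0, q.seq z (n + j) = q.seq x (n + j)) ∧
      ∀ n ≥ 0, q.seq z (n + j) = q.seq y (n + j) := by
    intro x y hxy
    obtain ⟨u, hu⟩ := shifted x
    obtain ⟨v, hv⟩ := shifted y
    simp only [hu, hv]
    exact q.exists_glue u v j (by rw [← hu, ← hv]; simpa using hxy)
  have mid : ∀ z : (b : κ) × (p.transit q i j a b × q.transit r j m b c),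
      q.seq z.2.1 j = z.1 ∧ q.seq z.2.2 j = z.1 := by
    rintro ⟨b, ⟨x, hx⟩, ⟨y, hy⟩⟩
    exact ⟨by simpa [q.base_zero] using hx.2 0 le_rfl, by simpa [q.base_zero] using hy.1 0 le_rfl⟩
  choose f hf hf' using fun z : (b : κ) × (p.transit q i j a b × q.transit r j m b c) =>
    glue z.2.1 z.2.2 ((mid z).1.trans (mid z).2.symm)
  symm
  refine Nat.card_congr (Equiv.ofBijective (fun z => (⟨f z, fun n hn => ?_, fun n hn => ?_⟩ :
    p.transit r i m a c)) ⟨fun z w hzw => ?_, fun y => ?_⟩)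
  · rw [past (hf z) n hn, z.2.1.2.1 n hn]
  · rw [future (hf' z) n hn, z.2.2.2.2 n hn]
  · have hzw : f z = f w := congrArg Subtype.val hzw
    have hz := hf z
    have hz' := hf' z
    have hw := hf w
    have hw' := hf' w
    rw [hzw] at hz hz'
    -- The intermediate symbol is recovered as the q-symbol of the glued point at time j. Each piece
    -- is then determined: one half of its q-sequence comes from the glued point, the other from the
    -- reference sequence.
    have hb : z.1 = w.1 := by
      rw [← (mid z).1, ← (mid w).1]
      simpa using (hz 0 le_rfl).symm.trans (hw 0 le_rfl)
    obtain ⟨b, ⟨x, hx⟩, ⟨y, hy⟩⟩ := z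
    obtain ⟨b', ⟨x', hx'⟩, ⟨y', hy'⟩⟩ := w
    obtain rfl : b = b' := hb
    have ext_at : ∀ {s t : X}, (∀ n, q.seq s (n + j) = q.seq t (n + j)) → s = t := fun h =>
      q.seq_ext fun n => by simpa using h (n - j)
    obtain rfl : x = x' := ext_at fun n => by
      rcases le_total n 0 with hn | hn
      · exact (hz n hn).symm.trans (hw n hn)
      · exact (hx.2 n hn).trans (hx'.2 n hn).symm
    obtain rfl : y = y' := ext_at fun n => by
      rcases le_total n 0 with hn | hn
      · exact (hy.1 n hn).trans (hy'.1 n hn).symm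
      · exact (hz' n hn).symm.trans (hw' n hn)
    rfl
  · obtain ⟨y, hy⟩ := y
    obtain ⟨v, hv⟩ := shifted y
    have h0 : v.1 0 = q.seq y j := by simpa using (hv 0).symm
    obtain ⟨x₁, h1, h1'⟩ := q.exists_glue v (q.base (q.seq y j)) j (by rw [q.base_zero, h0])
    obtain ⟨x₂, h2, h2'⟩ := q.exists_glue (q.base (q.seq y j)) v j (by rw [q.base_zero, h0])
    let z : (b : κ) × (p.transit q i j a b × q.transit r j m b c) :=
      ⟨q.seq y j,
        ⟨x₁, fun n hn => (past (fun n hn => (h1 n hn).trans (hv n).symm) n hn).trans (hy.1 n hn),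
          h1'⟩,
        ⟨x₂, h2, fun n hn =>
          (future (fun n hn => (h2' n hn).trans (hv n).symm) n hn).trans (hy.2 n hn)⟩⟩
    refine ⟨z, Subtype.ext (q.seq_ext fun n => ?_)⟩
    rw [← sub_add_cancel n j]
    rcases le_total (n - j) 0 with hn | hn
    · exact (hf z _ hn).trans ((h1 _ hn).trans (hv _).symm)
    · exact (hf' z _ hn).trans ((h2' _ hn).trans (hv _).symm)

theorem transfer_mul_transfer [Finite ι] [Fintype κ] {p : MarkovCoding X A}
    {q : MarkovCoding X B} {r : MarkovCoding X C} {k l l' : ℕ} (hqp : q.Determines k p)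
    (hqr : q.Determines l r) (hrq : r.Determines l' q) {i j m : ℤ} (hij : i + k ≤ j)
    (hjm : j + l ≤ m) : p.transfer q i j * q.transfer r j m = p.transfer r i m := by
  ext a c
  -- `Nat.card_sigma` needs finite fibres.
  have := finite_transit hqp i j
  have := finite_transit hrq j m
  simp only [Matrix.mul_apply, transfer, Matrix.of_apply]
  rw [card_transit_eq_card_sigma hqp hqr hij hjm, Nat.card_sigma]
  simp [Nat.card_prod]

/-- The prescribed past ends in a at time i and the prescribed future starts in b at time i + 1,
leaving no free coordinate: the concatenation is a point exactly when the transition from a to b is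
allowed. -/
theorem transfer_succ_self (hA : ∀ i j, A i j = 0 ∨ A i j = 1) (p : MarkovCoding X A) (i : ℤ) :
    p.transfer p i (i + 1) = A := by
  ext a b
  simp only [transfer, Matrix.of_apply]
  rcases hA a b with h | h
  · have : IsEmpty (p.transit p i (i + 1) a b) := ⟨fun x => by
      have h1 := x.2.1 0 le_rfl
      have h2 := x.2.2 0 le_rfl
      have h3 := p.seq_mem x.1 i
      rw [zero_add, p.base_zero] at h1 h2
      rw [h1, h2, h] at h3
      exact zero_ne_one h3⟩
    simp [h]
  · rw [h, Nat.cast_eq_one, Nat.card_eq_one_iff_unique]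
    refine ⟨⟨fun x y => Subtype.ext (p.seq_ext fun n => ?_)⟩, ?_⟩
    · rcases le_or_gt n i with hn | hn
      · have hx := x.2.1 (n - i) (by lia)
        have hy := y.2.1 (n - i) (by lia)
        rw [sub_add_cancel] at hx hy
        rw [hx, hy]
      · have hx := x.2.2 (n - (i + 1)) (by lia)
        have hy := y.2.2 (n - (i + 1)) (by lia)
        rw [sub_add_cancel] at hx hy
        rw [hx, hy]
    -- The reference future of b is delayed by one because `exists_join` reads its second sequence
    -- from time 1.
    · obtain ⟨y, h1, h2⟩ := p.exists_join (p.base a)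
        ⟨fun n => (p.base b).1 (n - 1), fun n => by
          simpa [sub_add_eq_add_sub] using (p.base b).2 (n - 1)⟩ i
        (by simpa [p.base_zero] using h)
      refine ⟨y, h1, fun n hn => ?_⟩
      simpa [add_assoc, add_comm 1 i] using h2 (n + 1) (by lia)

theorem transfer_self [Fintype ι] [DecidableEq ι] (hA : ∀ i j, A i j = 0 ∨ A i j = 1)
    (p : MarkovCoding X A) (n : ℕ) : p.transfer p 0 (n + 1) = A ^ (n + 1) := by
  induction n with
  | zero => simpa using p.transfer_succ_self hA 0
  | succ n ih =>
    have h := transfer_mul_transfer p.determines_self p.determines_self p.determines_self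
      (i := 0) (j := n + 1) (m := n + 1 + 1) (by lia) (by lia)
    rw [p.transfer_succ_self hA] at h
    rw [pow_succ, ← ih, h, Nat.cast_succ]

theorem transfer_add {p : MarkovCoding X A} {q : MarkovCoding X B} (σ : X ≃ X)
    (hp : ∀ x n, p.seq (σ x) n = p.seq x (n + 1)) (hq : ∀ x n, q.seq (σ x) n = q.seq x (n + 1))
    (i j : ℤ) (k : ℕ) : p.transfer q (i + k) (j + k) = p.transfer q i j := by
  induction k with
  | zero => simp
  | succ k ih =>
    rw [← ih]
    ext a b
    simp only [transfer, Matrix.of_apply, Nat.cast_inj]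
    refine Nat.card_congr (σ.subtypeEquiv fun x => ?_)
    simp [transit, hp, hq, add_assoc]

/-- Two codings that determine each other locally and carry the same shift have shift equivalent
matrices. -/
theorem exists_shiftEquivalence [Fintype ι] [DecidableEq ι] [Fintype κ] [DecidableEq κ]
    (hA : ∀ i j, A i j = 0 ∨ A i j = 1) (hB : ∀ i j, B i j = 0 ∨ B i j = 1)
    {p : MarkovCoding X A} {q : MarkovCoding X B} (σ : X ≃ X)
    (hp : ∀ x n, p.seq (σ x) n = p.seq x (n + 1)) (hq : ∀ x n, q.seq (σ x) n = q.seq x (n + 1))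
    {k : ℕ} (hpq : p.Determines k q) (hqp : q.Determines k p) :
    ∃ (R : Matrix ι κ ℤ) (S : Matrix κ ι ℤ) (l : ℕ), (∀ a b, 0 ≤ R a b) ∧ (∀ b a, 0 ≤ S b a) ∧
      A * R = R * B ∧ S * A = B * S ∧ R * S = A ^ l ∧ S * R = B ^ l := by
  -- Width k already suffices for composing; width k + 1 makes the exponent 2k + 2 of the products
  -- RS and SR positive, as `transfer_self` requires.
  have hR : p.transfer q (k + 1) (2 * k + 2) = p.transfer q 0 (k + 1) := by
    rw [← transfer_add σ hp hq 0 (k + 1) (k + 1)]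
    congr 1 <;> push_cast <;> ring
  have hS : q.transfer p (k + 1) (2 * k + 2) = q.transfer p 0 (k + 1) := by
    rw [← transfer_add σ hq hp 0 (k + 1) (k + 1)]
    congr 1 <;> push_cast <;> ring
  -- AR and RB are the same count from p to q over [0, k + 2], cut at time 1 through p or at time k
  -- + 1 through q. Likewise for BS and SA.
  have hAR := transfer_mul_transfer p.determines_self hpq hqp (i := 0) (j := 1)
    (m := k + 1 + 1) (by lia) (by lia)
  have hRB := transfer_mul_transfer hqp q.determines_self q.determines_self (i := 0)
    (j := k + 1) (m := k + 1 + 1) (by lia) (by lia)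
  have hBS := transfer_mul_transfer q.determines_self hqp hpq (i := 0) (j := 1)
    (m := k + 1 + 1) (by lia) (by lia)
  have hSA := transfer_mul_transfer hpq p.determines_self p.determines_self (i := 0)
    (j := k + 1) (m := k + 1 + 1) (by lia) (by lia)
  have hR1 : p.transfer q 1 (k + 1 + 1) = p.transfer q 0 (k + 1) := by
    simpa using transfer_add σ hp hq 0 (k + 1) 1
  have hS1 : q.transfer p 1 (k + 1 + 1) = q.transfer p 0 (k + 1) := by
    simpa using transfer_add σ hq hp 0 (k + 1) 1
  have hA1 : p.transfer p 0 1 = A := p.transfer_succ_self hA 0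
  have hB1 : q.transfer q 0 1 = B := q.transfer_succ_self hB 0
  rw [hA1, hR1] at hAR
  rw [hB1, hS1] at hBS
  rw [q.transfer_succ_self hB] at hRB
  rw [p.transfer_succ_self hA] at hSA
  refine ⟨p.transfer q 0 (k + 1), q.transfer p 0 (k + 1), 2 * k + 1 + 1, p.transfer_nonneg q _ _,
    q.transfer_nonneg p _ _, hAR.trans hRB.symm, hSA.trans hBS.symm, ?_, ?_⟩
  · rw [← p.transfer_self hA, ← hS, transfer_mul_transfer hqp hqp hpq (by simp) (by lia)]
    congr 1
  · rw [← q.transfer_self hB, ← hR, transfer_mul_transfer hpq hpq hqp (by simp) (by lia)]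
    congr 1

end MarkovCoding

/-! ### Codings given by a conjugacy -/

section Conjugacy

variable {ι κ : Type*} {A : Matrix ι ι ℤ} {B : Matrix κ κ ℤ}

/-- If every symbol has a successor and a predecessor, then every symbol occurs in the shift. -/
theorem exists_markovShift_zero_eq (hs : ∀ a, ∃ b, A a b = 1) (hp : ∀ a, ∃ b, A b a = 1) (a : ι) :
    ∃ x : MarkovShift A, x.1 0 = a := by
  choose s hs using hs
  choose p hp using hp
  refine ⟨⟨fun n => Int.casesOn n (fun m => s^[m] a) (fun m => p^[m + 1] a), fun n => ?_⟩, rfl⟩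
  match n with
  | Int.ofNat m =>
    change A (s^[m] a) (s^[m + 1] a) = 1
    rw [Function.iterate_succ_apply']
    exact hs _
  | Int.negSucc 0 => exact hp a
  | Int.negSucc (m + 1) =>
    change A (p^[m + 1 + 1] a) (p^[m + 1] a) = 1
    rw [Function.iterate_succ_apply']
    exact hp _

/-- Some positive power of A has a positive entry at (a, a), which is impossible if row a of A
vanishes. -/
theorem Matrix.IsIrreducible.exists_row_eq_one [Fintype ι] [DecidableEq ι]
    (hA : ∀ i j, A i j = 0 ∨ A i j = 1) (h : A.IsIrreducible) (a : ι) : ∃ b, A a b = 1 := by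
  obtain ⟨k, hk, hpos⟩ := (Matrix.isIrreducible_iff_exists_pow_pos h.nonneg).1 h a a
  obtain ⟨k, rfl⟩ := Nat.exists_eq_succ_of_ne_zero hk.ne'
  by_contra! hne
  rw [Nat.succ_eq_add_one, pow_succ', Matrix.mul_apply, Finset.sum_eq_zero fun b _ => by
    rw [(hA a b).resolve_right (hne b), zero_mul]] at hpos
  exact lt_irrefl _ hpos

theorem Matrix.IsIrreducible.exists_markovShift_zero_eq [Fintype ι] [DecidableEq ι]
    (hA : ∀ i j, A i j = 0 ∨ A i j = 1) (h : A.IsIrreducible) (a : ι) :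
    ∃ x : MarkovShift A, x.1 0 = a :=
  _root_.exists_markovShift_zero_eq (h.exists_row_eq_one hA)
    (Matrix.IsIrreducible.exists_row_eq_one (fun i j => hA j i) h.transpose) a

/-! ### Finite windows from compactness -/

variable [TopologicalSpace ι] [DiscreteTopology ι] [TopologicalSpace κ] [DiscreteTopology κ]

theorem isClosed_markovShift (A : Matrix ι ι ℤ) : IsClosed (MarkovShift A) := by
  have : MarkovShift A = ⋂ n : ℤ, (fun x : ℤ → ι => (x n, x (n + 1))) ⁻¹' {z | A z.1 z.2 = 1} := by
    ext x; simp [MarkovShift]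
  rw [this]
  exact isClosed_iInter fun n => (isClosed_discrete _).preimage
    ((continuous_apply n).prodMk (continuous_apply (n + 1)))

/-- A locally constant function on a Markov shift depends on finitely many coordinates. -/
theorem exists_window [Finite ι] {f : MarkovShift A → κ} (hf : Continuous f) :
    ∃ k : ℕ, ∀ x y : MarkovShift A,
      (∀ n : ℤ, -k ≤ n → n ≤ k → x.1 n = y.1 n) → f x = f y := by
  have : CompactSpace (MarkovShift A) :=
    isCompact_iff_compactSpace.1 (isClosed_markovShift A).isCompact
  by_contra! hne
  -- If no window works, these closed sets of pairs that agree on [-k, k] but have different values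
  -- are nonempty and decreasing. A common element is a pair of equal points with different values.
  let t : ℕ → Set (MarkovShift A × MarkovShift A) := fun k =>
    {z | (∀ n : ℤ, -k ≤ n → n ≤ k → z.1.1 n = z.2.1 n) ∧ f z.1 ≠ f z.2}
  have hcl : ∀ k, IsClosed (t k) := fun k => by
    refine IsClosed.inter ?_ ?_
    · have : {z : MarkovShift A × MarkovShift A | ∀ n : ℤ, -k ≤ n → n ≤ k → z.1.1 n = z.2.1 n} =
          ⋂ (n : ℤ) (_ : -k ≤ n) (_ : n ≤ k), {z | z.1.1 n = z.2.1 n} := by ext; simp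
      change IsClosed {z : MarkovShift A × MarkovShift A | ∀ n : ℤ, -k ≤ n → n ≤ k → z.1.1 n = z.2.1 n}
      rw [this]
      exact isClosed_iInter fun n => isClosed_iInter fun _ => isClosed_iInter fun _ =>
        isClosed_eq ((continuous_apply n).comp (continuous_subtype_val.comp continuous_fst))
          ((continuous_apply n).comp (continuous_subtype_val.comp continuous_snd))
    · exact (isClosed_discrete {w : κ × κ | w.1 ≠ w.2}).preimage (hf.prodMap hf)
  obtain ⟨z, hz⟩ := IsCompact.nonempty_iInter_of_sequence_nonempty_isCompact_isClosed t
    (fun k z hz => ⟨fun n h1 h2 => hz.1 n (by push_cast; lia) (by push_cast; lia), hz.2⟩)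
    (fun k => let ⟨x, y, h, h'⟩ := hne k; ⟨(x, y), h, h'⟩) (hcl 0).isCompact hcl
  rw [Set.mem_iInter] at hz
  exact (hz 0).2 (congrArg f (Subtype.ext (funext fun n =>
    (hz n.natAbs).1 n (by lia) (by lia))))

/-- Compactness gives a window for the coordinate at time 0, and equivariance carries it to every
time. All larger radii are allowed so that both directions of a conjugacy can share one. -/
theorem MarkovCoding.exists_determines [Finite ι] {X : Type*} {p : MarkovCoding X A}
    {q : MarkovCoding X B} (σ : X ≃ X)
    (hp : ∀ x n, p.seq (σ x) n = p.seq x (n + 1)) (hq : ∀ x n, q.seq (σ x) n = q.seq x (n + 1))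
    (hc : Continuous fun x => q.toEquiv (p.toEquiv.symm x)) :
    ∃ k₀ : ℕ, ∀ k ≥ k₀, p.Determines k q := by
  obtain ⟨k₀, h⟩ := exists_window ((continuous_apply (0 : ℤ)).comp (continuous_subtype_val.comp hc))
  refine ⟨k₀, fun k hk x y m hxy => ?_⟩
  -- The map τ is the m-th power of σ, negative m included.
  have key : ∀ m : ℤ, ∃ τ : X → X, (∀ x n, p.seq (τ x) n = p.seq x (n + m)) ∧
      ∀ x n, q.seq (τ x) n = q.seq x (n + m) := fun m => by
    induction m with
    | zero => exact ⟨id, by simp, by simp⟩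
    | succ i ih =>
      obtain ⟨τ, h1, h2⟩ := ih
      exact ⟨σ ∘ τ, fun x n => by simp [hp, h1]; congr 1; ring,
        fun x n => by simp [hq, h2]; congr 1; ring⟩
    | pred i ih =>
      obtain ⟨τ, h1, h2⟩ := ih
      have hp' : ∀ x n, p.seq (σ.symm x) n = p.seq x (n - 1) := fun x n => by
        simpa using (hp (σ.symm x) (n - 1)).symm
      have hq' : ∀ x n, q.seq (σ.symm x) n = q.seq x (n - 1) := fun x n => by
        simpa using (hq (σ.symm x) (n - 1)).symm
      exact ⟨σ.symm ∘ τ, fun x n => by simp [hp', h1]; congr 1; ring,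
        fun x n => by simp [hq', h2]; congr 1; ring⟩
  obtain ⟨τ, h1, h2⟩ := key m
  have := h (p.toEquiv (τ x)) (p.toEquiv (τ y)) fun n hn hn' => by
    have := hxy (n + m) (by lia) (by lia)
    rwa [← h1, ← h1] at this
  have h3 : q.seq (τ x) 0 = q.seq (τ y) 0 := by simpa [seq] using this
  simpa [h2] using h3

/-- Topologically conjugate irreducible `0`-`1` matrices are shift equivalent. -/
theorem TopologicallyConjugate.exists_shiftEquivalence [Fintype ι] [DecidableEq ι] [Fintype κ]
    [DecidableEq κ] (hA : ∀ i j, A i j = 0 ∨ A i j = 1) (hB : ∀ i j, B i j = 0 ∨ B i j = 1)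
    (hAirr : A.IsIrreducible) (hBirr : B.IsIrreducible) (hconj : TopologicallyConjugate A B) :
    ∃ (R : Matrix ι κ ℤ) (S : Matrix κ ι ℤ) (l : ℕ), (∀ a b, 0 ≤ R a b) ∧ (∀ b a, 0 ≤ S b a) ∧
      A * R = R * B ∧ S * A = B * S ∧ R * S = A ^ l ∧ S * R = B ^ l := by
  obtain ⟨h, hh⟩ := hconj
  choose u hu using hAirr.exists_markovShift_zero_eq hA
  choose v hv using hBirr.exists_markovShift_zero_eq hB
  -- Both codings live on the shift of A: p reads a point directly, q reads its image under h.
  let p : MarkovCoding (MarkovShift A) A := ⟨Equiv.refl _, u, hu⟩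
  let q : MarkovCoding (MarkovShift A) B := ⟨h.toEquiv, v, hv⟩
  let σ : MarkovShift A ≃ MarkovShift A := (markovShiftMap A).toEquiv
  have hp : ∀ x n, p.seq (σ x) n = p.seq x (n + 1) := fun _ _ => rfl
  have hq : ∀ x n, q.seq (σ x) n = q.seq x (n + 1) := fun x n =>
    congrFun (congrArg Subtype.val (hh x)) n
  obtain ⟨k₁, h₁⟩ := MarkovCoding.exists_determines (p := p) (q := q) σ hp hq h.continuous
  obtain ⟨k₂, h₂⟩ := MarkovCoding.exists_determines (p := q) (q := p) σ hq hp h.symm.continuous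
  exact MarkovCoding.exists_shiftEquivalence hA hB σ hp hq (h₁ (max k₁ k₂) (le_max_left _ _))
    (h₂ (max k₁ k₂) (le_max_right _ _))

end Conjugacy

/-! ### Isomorphisms of dimension groups induced by shift equivalences -/

section DimensionIso

theorem mulVec_nonneg_of_nonneg {ι κ : Type*} [Fintype ι] {T : Matrix κ ι ℤ} (hT : ∀ a b, 0 ≤ T a b) {v : ι → ℤ}
    (hv : 0 ≤ v) : 0 ≤ T.mulVec v :=
  fun a => Finset.sum_nonneg fun b _ => mul_nonneg (hT a b) (hv b)

variable {ι κ : Type*} [Fintype ι] [DecidableEq ι] [Fintype κ] [DecidableEq κ]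
  {A : Matrix ι ι ℤ} {B : Matrix κ κ ℤ}

theorem dimClass_add (A : Matrix ι ι ℤ) (v w : ι → ℤ) (n : ℕ) :
    dimClass A (v + w) n = dimClass A v n + dimClass A w n :=
  map_add (Module.DirectLimit.of ℤ ℕ (fun _ : ℕ => ι → ℤ) (dimMap A) n) v w

theorem dimClass_pow (A : Matrix ι ι ℤ) (v : ι → ℤ) (n k : ℕ) :
    dimClass A ((A.transpose ^ k).mulVec v) (n + k) = dimClass A v n := by
  induction k with
  | zero => simp
  | succ k ih => rw [pow_succ', ← Matrix.mulVec_mulVec, ← add_assoc, dimClass_succ, ih]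

theorem dimClass_eq_sum (A : Matrix ι ι ℤ) (v : ι → ℤ) (n : ℕ) :
    dimClass A v n = ∑ i, v i • dimClass A (Pi.single i 1) n := by
  let F : (ι → ℤ) →+ DimGroup A := AddMonoidHom.mk' (dimClass A · n) (dimClass_add A · · n)
  change F v = ∑ i, v i • F (Pi.single i 1)
  conv_lhs => rw [pi_eq_sum_univ' v, map_sum]
  exact Finset.sum_congr rfl fun i _ => map_zsmul F _ _

theorem dimHom_compat {T : Matrix κ ι ℤ} (hT : T * A.transpose = B.transpose * T) (i j : ℕ)
    (hij : i ≤ j) : T.mulVecLin ∘ₗ dimMap A i j hij = dimMap B i j hij ∘ₗ T.mulVecLin := by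
  simp only [dimMap, ← Matrix.mulVecLin_mul]
  congr 1
  induction j - i with
  | zero => simp
  | succ n ih => rw [pow_succ, pow_succ, ← Matrix.mul_assoc, ih, Matrix.mul_assoc, hT, Matrix.mul_assoc]

/-- The homomorphism `[v, n] ↦ [T v, n]` given by a matrix intertwining `Aᵗ` and `Bᵗ`. -/
noncomputable def dimHom (T : Matrix κ ι ℤ) (hT : T * A.transpose = B.transpose * T) :
    DimGroup A →+ DimGroup B :=
  LinearMap.toAddMonoidHom (Module.DirectLimit.map (f := dimMap A) (f' := dimMap B)
    (fun _ => T.mulVecLin) (dimHom_compat hT))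

theorem dimHom_dimClass (T : Matrix κ ι ℤ) (hT : T * A.transpose = B.transpose * T) (v : ι → ℤ)
    (n : ℕ) : dimHom T hT (dimClass A v n) = dimClass B (T.mulVec v) n :=
  Module.DirectLimit.map_apply_of (fun _ => T.mulVecLin) (dimHom_compat hT) v

/-- Intertwining matrices `T` and `U` whose products are powers of `Aᵗ` and `Bᵗ` induce an
isomorphism of dimension groups, `[v, n] ↦ [T v, n]` with inverse `[v, n] ↦ [U v, n + l]`. -/
theorem exists_dimGroup_equiv {T : Matrix κ ι ℤ} {U : Matrix ι κ ℤ} {l : ℕ}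
    (hT : T * A.transpose = B.transpose * T) (hU : U * B.transpose = A.transpose * U)
    (hUT : U * T = A.transpose ^ l) (hTU : T * U = B.transpose ^ l) :
    ∃ f : DimGroup A ≃+ DimGroup B,
      (∀ v n, f (dimClass A v n) = dimClass B (T.mulVec v) n) ∧
      ∀ v n, f.symm (dimClass B v n) = dimClass A (U.mulVec v) (n + l) := by
  have hs : ∀ v n, (dimShift A)^[l] (dimClass A v n) = dimClass A v (n + l) := fun v n => by
    clear hUT hTU
    induction l with
    | zero => rfl
    | succ l ih => rw [Function.iterate_succ_apply', ih, dimShift_dimClass, add_assoc]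
  have hinv : ∀ v n, (dimShift A)^[l] (dimHom U hU (dimClass B v n)) =
      dimClass A (U.mulVec v) (n + l) := fun v n => by rw [dimHom_dimClass, hs]
  refine ⟨{ toFun := dimHom T hT
            invFun := fun x => (dimShift A)^[l] (dimHom U hU x)
            left_inv := fun x => ?_
            right_inv := fun x => ?_
            map_add' := map_add _ }, dimHom_dimClass T hT, hinv⟩
  · obtain ⟨v, n, rfl⟩ := exists_dimClass A x
    change (dimShift A)^[l] (dimHom U hU (dimHom T hT _)) = _
    rw [dimHom_dimClass, hinv, Matrix.mulVec_mulVec, hUT, dimClass_pow]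
  · obtain ⟨v, n, rfl⟩ := exists_dimClass B x
    change dimHom T hT ((dimShift A)^[l] (dimHom U hU _)) = _
    rw [hinv, dimHom_dimClass, Matrix.mulVec_mulVec, hTU, dimClass_pow]

/-! ### Cone, distinguished element and automorphism of the tensor product -/

theorem map_mem_biDimCone (Φ : BiDimGroup A →+ BiDimGroup B)
    (h : ∀ a ∈ dimCone A.transpose, ∀ b ∈ dimCone A, Φ (a ⊗ₜ[ℤ] b) ∈ biDimCone B)
    {z : BiDimGroup A} (hz : z ∈ biDimCone A) : Φ z ∈ biDimCone B := by
  have : biDimCone A ≤ (biDimCone B).comap Φ := by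
    refine AddSubmonoid.closure_le.2 ?_
    rintro _ ⟨a, ha, b, hb, rfl⟩
    exact h a ha b hb
  exact this hz

/-- A bilinear substitution rule for sums of elementary tensors of basis classes. -/
theorem sum_smul_dimClass_tmul (P : Matrix κ ι ℤ) (M : Matrix ι ι ℤ) (Q : Matrix ι κ ℤ)
    (m n : ℕ) :
    ∑ i, ∑ j, M i j • (dimClass B.transpose (P.mulVec (Pi.single i 1)) m ⊗ₜ[ℤ]
        dimClass B (Q.transpose.mulVec (Pi.single j 1)) n) =
      ∑ k, ∑ l, (P * M * Q) k l •
        (dimClass B.transpose (Pi.single k 1) m ⊗ₜ[ℤ] dimClass B (Pi.single l 1) n) := by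
  have h : ∀ i j, dimClass B.transpose (P.mulVec (Pi.single i 1)) m ⊗ₜ[ℤ]
      dimClass B (Q.transpose.mulVec (Pi.single j 1)) n = ∑ k, ∑ l, (P k i * Q j l) •
        (dimClass B.transpose (Pi.single k 1) m ⊗ₜ[ℤ] dimClass B (Pi.single l 1) n) := by
    intro i j
    rw [dimClass_eq_sum B.transpose, dimClass_eq_sum B, TensorProduct.sum_tmul]
    refine Finset.sum_congr rfl fun k _ => ?_
    rw [TensorProduct.tmul_sum]
    refine Finset.sum_congr rfl fun l _ => ?_
    rw [TensorProduct.smul_tmul_smul]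
    simp
  simp only [h, Finset.smul_sum, smul_smul]
  calc _ = ∑ i, ∑ k, ∑ j, ∑ l, (M i j * (P k i * Q j l)) •
        (dimClass B.transpose (Pi.single k 1) m ⊗ₜ[ℤ] dimClass B (Pi.single l 1) n) :=
        Finset.sum_congr rfl fun i _ => Finset.sum_comm
    _ = ∑ k, ∑ i, ∑ l, ∑ j, (M i j * (P k i * Q j l)) •
        (dimClass B.transpose (Pi.single k 1) m ⊗ₜ[ℤ] dimClass B (Pi.single l 1) n) := by
        rw [Finset.sum_comm]
        exact Finset.sum_congr rfl fun k _ => Finset.sum_congr rfl fun i _ => Finset.sum_comm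
    _ = _ := by
        refine Finset.sum_congr rfl fun k _ => ?_
        rw [Finset.sum_comm]
        refine Finset.sum_congr rfl fun l _ => ?_
        simp only [← Finset.sum_smul]
        congr 1
        simp only [Matrix.mul_apply, Finset.sum_mul]
        rw [Finset.sum_comm]
        exact Finset.sum_congr rfl fun j _ => Finset.sum_congr rfl fun i _ => by ring

theorem biDimUnit_eq_sum (A : Matrix ι ι ℤ) :
    biDimUnit A = ∑ i, ∑ j, A i j •
      (dimClass A.transpose (Pi.single i 1) 1 ⊗ₜ[ℤ] dimClass A (Pi.single j 1) 1) := by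
  rw [biDimUnit, Finset.sum_comm]
  simp only [TensorProduct.tmul_smul]

/-- Writing [e_j, 1] as [(Aᵗ)^l e_j, 1 + l] in the second factor moves A^l into the coefficients.
This is the form in which the image of a distinguished element appears after a delay by l. -/
theorem biDimUnit_eq_sum_pow (A : Matrix ι ι ℤ) (l : ℕ) :
    biDimUnit A = ∑ i, ∑ j, (A ^ (l + 1)) i j •
      (dimClass A.transpose (Pi.single i 1) 1 ⊗ₜ[ℤ] dimClass A (Pi.single j 1) (1 + l)) := by
  have h := sum_smul_dimClass_tmul (B := A) 1 A (A ^ l) 1 (1 + l)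
  rw [one_mul, ← pow_succ'] at h
  rw [← h, biDimUnit_eq_sum]
  simp only [Matrix.transpose_pow, dimClass_pow, Matrix.one_mulVec]

theorem biDimAut_tmul (A : Matrix ι ι ℤ) (v w : ι → ℤ) (m n : ℕ) :
    biDimAut A (dimClass A.transpose v m ⊗ₜ[ℤ] dimClass A w n) =
      dimClass A.transpose (A.mulVec v) m ⊗ₜ[ℤ] dimClass A w (n + 1) := by
  have h : biDimAut A (dimClass A.transpose v m ⊗ₜ[ℤ] dimClass A w n) =
    dimUnshift A.transpose (dimClass A.transpose v m) ⊗ₜ[ℤ] dimShift A (dimClass A w n) := rfl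
  rw [h, dimUnshift_dimClass, dimShift_dimClass, Matrix.transpose_transpose]

/-- A nonnegative shift equivalence of matrices induces an isomorphism of dimension quadruplets. -/
theorem dimQuadrupletIso_of_shiftEquivalence {R : Matrix ι κ ℤ} {S : Matrix κ ι ℤ} {l : ℕ}
    (hR : ∀ a b, 0 ≤ R a b) (hS : ∀ b a, 0 ≤ S b a) (hAR : A * R = R * B) (hSA : S * A = B * S)
    (hRS : R * S = A ^ l) (hSR : S * R = B ^ l) : DimQuadrupletIso A B := by
  obtain ⟨f, hf, hf'⟩ := exists_dimGroup_equiv (A := A.transpose) (B := B.transpose) (T := S)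
    (U := R) (l := l) (by simpa using hSA) (by simpa using hAR.symm) (by simpa using hRS)
    (by simpa using hSR)
  -- The map g goes from B to A through Sᵗ, so that its inverse [w, n] ↦ [Rᵗw, n + l] carries the
  -- delay l. The undelayed map [w, n] ↦ [Rᵗw, n] would leave B^(l+1) at stages (1, 1).
  obtain ⟨g, hg, hg'⟩ := exists_dimGroup_equiv (A := B) (B := A) (T := S.transpose)
    (U := R.transpose) (l := l)
    (by simpa [Matrix.transpose_mul] using congrArg Matrix.transpose hSA.symm)
    (by simpa [Matrix.transpose_mul] using congrArg Matrix.transpose hAR)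
    (by simpa [Matrix.transpose_mul] using congrArg Matrix.transpose hSR)
    (by simpa [Matrix.transpose_mul] using congrArg Matrix.transpose hRS)
  let Φ : BiDimGroup A ≃+ BiDimGroup B :=
    (TensorProduct.congr f.toIntLinearEquiv g.symm.toIntLinearEquiv).toAddEquiv
  have hΦ : ∀ a b, Φ (a ⊗ₜ[ℤ] b) = f a ⊗ₜ[ℤ] g.symm b := fun _ _ => rfl
  have hΦ' : ∀ a b, Φ.symm (a ⊗ₜ[ℤ] b) = f.symm a ⊗ₜ[ℤ] g b := fun _ _ => rfl
  have hR' : ∀ a b, 0 ≤ R.transpose a b := fun a b => hR b a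
  have hS' : ∀ a b, 0 ≤ S.transpose a b := fun a b => hS b a
  refine ⟨Φ, Set.Subset.antisymm ?_ fun z hz => ⟨Φ.symm z, ?_, Φ.apply_symm_apply z⟩,
    fun z => ?_, ?_⟩
  · rintro _ ⟨z, hz, rfl⟩
    refine map_mem_biDimCone Φ.toAddMonoidHom ?_ hz
    rintro _ ⟨v, m, hv, rfl⟩ _ ⟨w, n, hw, rfl⟩
    refine AddSubmonoid.subset_closure ⟨_, ⟨_, _, mulVec_nonneg_of_nonneg hS hv, hf v m⟩,
      _, ⟨_, _, mulVec_nonneg_of_nonneg hR' hw, hg' w n⟩, rfl⟩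
  · refine map_mem_biDimCone Φ.symm.toAddMonoidHom ?_ hz
    rintro _ ⟨v, m, hv, rfl⟩ _ ⟨w, n, hw, rfl⟩
    refine AddSubmonoid.subset_closure ⟨_, ⟨_, _, mulVec_nonneg_of_nonneg hR hv, hf' v m⟩,
      _, ⟨_, _, mulVec_nonneg_of_nonneg hS' hw, hg w n⟩, rfl⟩
  · induction z using TensorProduct.induction_on with
    | zero => simp only [map_zero]
    | add x y hx hy => simp only [map_add, hx, hy]
    | tmul a b =>
      obtain ⟨v, m, rfl⟩ := exists_dimClass _ a
      obtain ⟨w, n, rfl⟩ := exists_dimClass _ b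
      rw [biDimAut_tmul, hΦ, hΦ, hf, hf, hg', hg', biDimAut_tmul, Matrix.mulVec_mulVec,
        Matrix.mulVec_mulVec, hSA, add_right_comm]
  -- The coefficient matrix of the image is SAR = BSR = B^(l+1), at stages 1 and 1 + l.
  · rw [biDimUnit_eq_sum, biDimUnit_eq_sum_pow B l]
    simp only [map_sum, map_zsmul, hΦ, hf, hg']
    rw [sum_smul_dimClass_tmul, hSA, Matrix.mul_assoc, hSR, ← pow_succ']

end DimensionIso

theorem mainTheorem10 {N M : ℕ} (A : Matrix (Fin N) (Fin N) ℤ) (B : Matrix (Fin M) (Fin M) ℤ)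
    (hA01 : ∀ i j, A i j = 0 ∨ A i j = 1) (hB01 : ∀ i j, B i j = 0 ∨ B i j = 1)
    (hAirr : A.IsIrreducible) (hBirr : B.IsIrreducible)
    (hAperm : ¬ IsPermutationMatrix A) (hBperm : ¬ IsPermutationMatrix B)
    (hconj : TopologicallyConjugate A B) :
    DimQuadrupletIso A B := by
  obtain ⟨R, S, l, hR, hS, hAR, hSA, hRS, hSR⟩ :=
    hconj.exists_shiftEquivalence hA01 hB01 hAirr hBirr
  exact dimQuadrupletIso_of_shiftEquivalence hR hS hAR hSA hRS hSR
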